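/- An ascent sequence of length $n$ is a sequence $x_1x_2\cdots x_n$ of non-negative integers such that $x_1=0$ and, for $1<i\le n$, $x_i\le \mathrm{asc}(x_1\cdots x_{i-1})+1$, where $\mathrm{asc}(y_1\cdots y_m)$ is the number of indices $1\le j<m$ with $y_j<y_{j+1}$. Such a sequence avoids the pattern $0021$ if there are no indices $1\le i_1<i_2<i_3<i_4\le n$ with $x_{i_1}=x_{i_2}<x_{i_4}<x_{i_3}$. Let $\mathcal{A}_{0021}(n)$ be the set of ascent sequences of length $n$ that avoid $0021$. Then for every integer $n\ge 1$, $$\left|\mathcal{A}_{0021}(n)\right|=\sum_{k=0}^{n-1}\binom{n-1}{k}C_k,$$ where $C_k=\frac{1}{k+1}\binom{2k}{k}$ denotes the $k$-th Catalan number. -/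

import Mathlib

/-- The number of ascents of a word `x`, i.e. of positions `j` such that the letter at position `j`
is smaller than the letter at position `j + 1`. -/
def asc (x : List ℕ) : ℕ :=
  (x.zip x.tail).countP (fun p => decide (p.1 < p.2))

/-- A word `x` of natural numbers is an ascent sequence if its first letter is `0` and every later
letter is at most one more than the number of ascents of the prefix strictly before it
(positions are counted from `0`). -/
def IsAscentSeq (x : List ℕ) : Prop :=
  (∀ h : 0 < x.length, x[0] = 0) ∧
    ∀ (i : ℕ) (h : i < x.length), 0 < i → x[i] ≤ asc (x.take i) + 1

/-- The reduction of a word: every letter is replaced by the number of distinct smaller letters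
occurring in the word, so that the `i`-th smallest letters become `i - 1`. -/
def red (x : List ℕ) : List ℕ :=
  x.map (fun a => (x.toFinset.filter (fun b => b < a)).card)

/-- The word `x` contains the pattern `p` if some (not necessarily contiguous) subsequence of `x`
has reduction `p`. -/
def ContainsPattern (x p : List ℕ) : Prop :=
  ∃ y : List ℕ, y.Sublist x ∧ red y = p

/-- The set of ascent sequences of length `n` that avoid all patterns in the list `B`. -/
def avoidingAscentSeqs (B : List (List ℕ)) (n : ℕ) : Set (List ℕ) :=
  {x | x.length = n ∧ IsAscentSeq x ∧ ∀ p ∈ B, ¬ ContainsPattern x p}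

/-!
The proof runs through the generating tree in which the children of a word `x` are the words `x t`
that are again `0021`-avoiding ascent sequences. Label `x` by its number `r` of children. The claim
is that, for `n ≥ 1`, the labels of the words of length `n + 1` are obtained from those of the words
of length `n` by the rule `r ↦ r, 3, 4, …, r + 1` (`labelSum_succ`). This is not true child by
child, but it is true for the multisets of labels.

For `n ≥ 1`, an avoider of length `n + 1` is of exactly one of three kinds.
* It has a single zero. Then it is `0 (u + 1)` for an avoider `u` of length `n`, and its label is
  one more than that of `u`.
* It is `x 0` with `x` an avoider of length `n`. Then its label is that of `x`.
* It has two zeros and ends in a positive letter. Then it is `y t` with `y` an avoider with two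
  zeros. After two zeros the positive letters increase weakly, so the letters that may follow `y t`
  are `0`, those letters `≥ t` that may follow `y`, and one new letter if the step to `t` is an
  ascent (`mem_nextLetters_concat`). Hence the labels of the children `y t`, `t > 0`, are
  `3, …, r + 1` if `y` ends in zero, and `r, 3, …, r` otherwise (`sum_posNextLetters`).

Write `M n f` (`labelSum`) for the sum of `f r` over all avoiders of length `n`, `B n f`
(`posLabelSum`) for that over words of the third kind, `U f r = f 3 + ⋯ + f (r + 1)` (`succSum`) and
`S f r = f (r + 1)`. The description above gives, for `n ≥ 1`, two recurrences,
`M (n + 1) f = M n f + M n (S f) + B (n + 1) f` and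
`B (n + 1) f = M n (U f) - M (n - 1) (S (U f)) + B n (f - S f)`.
With `S (U f) = U f + S (S f)`, induction yields `B (n + 1) f = M n (U f) - M n (S f)`
(`posLabelSum_eq`), so `M (n + 1) f = M n ((1 + U) f)`. Since `M 1 f = f 2`, the number of avoiders
of length `n` is `(1 + U) ^ (n - 1)` applied to the constant `1`, at `2`. The binomial theorem and
the ballot number formula for `U ^ k` (`succSum_pow_one`), whose value at `2` is the `k`-th Catalan
number, finish the count.
-/

/-! ### Words and the pattern `0021` -/

/-- The word `x` has no subword `a a c d` with `a < d < c`. -/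
def Avoids0021 (x : List ℕ) : Prop :=
  ∀ a c d : ℕ, a < d → d < c → ¬ [a, a, c, d].Sublist x

theorem red_eq_0021_iff (y : List ℕ) :
    red y = [0, 0, 2, 1] ↔ ∃ a c d, a < d ∧ d < c ∧ y = [a, a, c, d] := by
  constructor
  · intro h
    have hlen : y.length = 4 := by simpa [red] using congrArg List.length h
    obtain ⟨a, b, c, d, rfl⟩ : ∃ a b c d, y = [a, b, c, d] := by
      match y, hlen with
      | [a, b, c, d], _ => exact ⟨a, b, c, d, rfl⟩
    set S := [a, b, c, d].toFinset with hS
    have haS : a ∈ S := by simp [hS]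
    have hbS : b ∈ S := by simp [hS]
    have h' : (S.filter (· < a)).card = 0 ∧ (S.filter (· < b)).card = 0 ∧
        (S.filter (· < c)).card = 2 ∧ (S.filter (· < d)).card = 1 := by
      simpa only [red, List.map_cons, List.map_nil, List.cons.injEq, and_true] using h
    obtain ⟨ha, hb, hc, hd⟩ := h'
    have mono : ∀ u v : ℕ, u ≤ v → (S.filter (· < u)).card ≤ (S.filter (· < v)).card :=
      fun u v huv => Finset.card_le_card fun w hw => by
        simp only [Finset.mem_filter] at hw ⊢
        exact ⟨hw.1, hw.2.trans_le huv⟩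
    have hab : a = b := by
      rw [Finset.card_eq_zero, Finset.filter_eq_empty_iff] at ha hb
      have h1 := ha hbS
      have h2 := hb haS
      omega
    have had : a < d := by
      by_contra hlt
      have := mono d a (by omega)
      omega
    have hdc : d < c := by
      by_contra hlt
      have := mono c d (by omega)
      omega
    exact ⟨a, c, d, had, hdc, by rw [hab]⟩
  · rintro ⟨a, c, d, had, hdc, rfl⟩
    have hac := had.trans hdc
    simp [red, Finset.filter_insert, Finset.filter_singleton, had, hdc, hac, had.not_gt,
      hdc.not_gt, hac.not_gt, had.ne]

theorem not_containsPattern_iff (x : List ℕ) :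
    ¬ ContainsPattern x [0, 0, 2, 1] ↔ Avoids0021 x := by
  simp only [ContainsPattern, red_eq_0021_iff, Avoids0021]
  constructor
  · intro h a c d had hdc hs
    exact h ⟨_, hs, a, c, d, had, hdc, rfl⟩
  · rintro h ⟨y, hs, a, c, d, had, hdc, rfl⟩
    exact h a c d had hdc hs

theorem concat_sublist_concat_iff (l x : List ℕ) (d e : ℕ) :
    (l ++ [d]).Sublist (x ++ [e]) ↔ (l ++ [d]).Sublist x ∨ (d = e ∧ l.Sublist x) := by
  rw [← List.reverse_sublist, ← List.reverse_sublist (l₂ := x), ← List.reverse_sublist (l₂ := x)]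
  simp only [List.reverse_append, List.reverse_cons, List.reverse_nil, List.nil_append,
    List.singleton_append]
  rw [List.sublist_cons_iff]
  simp only [List.cons.injEq]
  constructor
  · rintro (h | ⟨r, ⟨rfl, rfl⟩, h⟩)
    · exact Or.inl h
    · exact Or.inr ⟨rfl, h⟩
  · rintro (h | ⟨rfl, h⟩)
    · exact Or.inl h
    · exact Or.inr ⟨_, ⟨rfl, rfl⟩, h⟩

theorem four_sublist_concat_iff (x : List ℕ) (a b c d e : ℕ) :
    [a, b, c, d].Sublist (x ++ [e]) ↔
      [a, b, c, d].Sublist x ∨ (d = e ∧ [a, b, c].Sublist x) :=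
  concat_sublist_concat_iff [a, b, c] x d e

theorem three_sublist_concat_iff (x : List ℕ) (a b c e : ℕ) :
    [a, b, c].Sublist (x ++ [e]) ↔ [a, b, c].Sublist x ∨ (c = e ∧ [a, b].Sublist x) :=
  concat_sublist_concat_iff [a, b] x c e

theorem avoids0021_concat (x : List ℕ) (t : ℕ) :
    Avoids0021 (x ++ [t]) ↔
      Avoids0021 x ∧ ∀ a c, a < t → t < c → ¬ [a, a, c].Sublist x := by
  simp only [Avoids0021, four_sublist_concat_iff]
  constructor
  · intro h
    exact ⟨fun a c d had hdc hs => h a c d had hdc (Or.inl hs),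
      fun a c hat htc hs => h a c t hat htc (Or.inr ⟨rfl, hs⟩)⟩
  · rintro ⟨h1, h2⟩ a c d had hdc (hs | ⟨rfl, hs⟩)
    · exact h1 a c d had hdc hs
    · exact h2 a c had hdc hs

/-! ### Ascents -/

theorem asc_cons_cons (a b : ℕ) (x : List ℕ) :
    asc (a :: b :: x) = asc (b :: x) + if a < b then 1 else 0 := by
  simp [asc, List.countP_cons]

theorem asc_concat (x : List ℕ) (hx : x ≠ []) (t : ℕ) :
    asc (x ++ [t]) = asc x + if x.getLastD 0 < t then 1 else 0 := by
  induction x with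
  | nil => exact absurd rfl hx
  | cons a x ih =>
    cases x with
    | nil => simp [asc, List.countP_cons]
    | cons b x =>
      have := ih (by simp)
      simp only [List.cons_append] at this ⊢
      rw [asc_cons_cons, this, asc_cons_cons]
      simp only [List.getLastD_cons]
      omega

theorem asc_zero_cons_map_succ (u : List ℕ) (hu : u ≠ []) :
    asc (0 :: u.map Nat.succ) = asc u + 1 := by
  induction u with
  | nil => exact absurd rfl hu
  | cons a u ih =>
    have key : ∀ (v : List ℕ), asc (v.map Nat.succ) = asc v := by
      intro v
      induction v with
      | nil => rfl
      | cons c v ihv =>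
        cases v with
        | nil => rfl
        | cons d v =>
          simp only [List.map_cons] at ihv ⊢
          rw [asc_cons_cons, ihv, asc_cons_cons]
          simp
    have := key (a :: u)
    simp only [List.map_cons] at this ⊢
    rw [asc_cons_cons, this]
    simp

theorem isAscentSeq_concat (x : List ℕ) (t : ℕ) :
    IsAscentSeq (x ++ [t]) ↔
      IsAscentSeq x ∧ t < if x = [] then 1 else asc x + 2 := by
  rcases eq_or_ne x [] with rfl | hx
  · simp [IsAscentSeq]
  have hpos : 0 < x.length := List.length_pos_iff.2 hx
  simp only [hx, if_false, IsAscentSeq]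
  constructor
  · rintro ⟨h0, h1⟩
    refine ⟨⟨fun h => ?_, fun i hi hi0 => ?_⟩, ?_⟩
    · have := h0 (by simp)
      rwa [List.getElem_append_left h] at this
    · have := h1 i (by simp; omega) hi0
      rwa [List.getElem_append_left hi, List.take_append_of_le_length hi.le] at this
    · have := h1 x.length (by simp) hpos
      simp at this
      omega
  · rintro ⟨⟨h0, h1⟩, h2⟩
    refine ⟨fun _ => ?_, fun i hi hi0 => ?_⟩
    · rw [List.getElem_append_left hpos]
      exact h0 hpos
    · rcases Nat.lt_or_ge i x.length with hlt | hge
      · rw [List.getElem_append_left hlt, List.take_append_of_le_length hlt.le]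
        exact h1 i hlt hi0
      · have : i = x.length := by simp at hi; omega
        subst this
        simp
        omega

/-- The letters of an ascent sequence are bounded by its number of ascents. -/
theorem IsAscentSeq.le_asc {x : List ℕ} (hx : IsAscentSeq x) : ∀ a ∈ x, a ≤ asc x := by
  induction x using List.reverseRecOn with
  | nil => simp
  | append_singleton x t ih =>
    rw [isAscentSeq_concat] at hx
    rcases eq_or_ne x [] with rfl | hne
    · simp at hx
      simp [hx.2]
    have ih := ih hx.1
    have hlast : x.getLastD 0 ≤ asc x := by
      rw [List.getLastD_eq_getLast?, List.getLast?_eq_some_getLast hne]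
      exact ih _ (List.getLast_mem hne)
    have ht := hx.2
    rw [if_neg hne] at ht
    rw [asc_concat x hne]
    intro a ha
    rw [List.mem_append, List.mem_singleton] at ha
    rcases ha with ha | rfl
    · exact (ih a ha).trans (Nat.le_add_right _ _)
    · split_ifs <;> omega

/-! ### The generating tree -/

open scoped Classical in
/-- The letters `t` for which appending `t` to `x` keeps `x` an ascent sequence avoiding `0021`,
provided that `x` is one already. -/
noncomputable def nextLetters (x : List ℕ) : Finset ℕ :=
  (Finset.range (if x = [] then 1 else asc x + 2)).filter
    fun t => ∀ a c, a < t → t < c → ¬ [a, a, c].Sublist x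

theorem mem_nextLetters {x : List ℕ} {t : ℕ} :
    t ∈ nextLetters x ↔ (t < if x = [] then 1 else asc x + 2) ∧
      ∀ a c, a < t → t < c → ¬ [a, a, c].Sublist x := by
  simp [nextLetters]

theorem mem_nextLetters_of_ne_nil {x : List ℕ} (hx : x ≠ []) {t : ℕ} :
    t ∈ nextLetters x ↔ t ≤ asc x + 1 ∧ ∀ a c, a < t → t < c → ¬ [a, a, c].Sublist x := by
  rw [mem_nextLetters, if_neg hx, Nat.lt_succ_iff]

theorem zero_mem_nextLetters (x : List ℕ) : 0 ∈ nextLetters x := by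
  rw [mem_nextLetters]
  refine ⟨?_, fun a c h => absurd h (Nat.not_lt_zero a)⟩
  split_ifs <;> omega

theorem nextLetters_nil : nextLetters [] = {0} := by
  ext t
  simp [mem_nextLetters]

/-- The `0021`-avoiding ascent sequences of length `n`. -/
noncomputable def avoiders : ℕ → Finset (List ℕ)
  | 0 => {[]}
  | n + 1 => (avoiders n).biUnion fun x => (nextLetters x).image fun t => x ++ [t]

theorem mem_avoiders {n : ℕ} {x : List ℕ} :
    x ∈ avoiders n ↔ x.length = n ∧ IsAscentSeq x ∧ Avoids0021 x := by
  induction n generalizing x with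
  | zero =>
    simp only [avoiders, Finset.mem_singleton, List.length_eq_zero_iff]
    constructor
    · rintro rfl
      simp [IsAscentSeq, Avoids0021]
    · exact And.left
  | succ n ih =>
    simp only [avoiders, Finset.mem_biUnion, Finset.mem_image]
    constructor
    · rintro ⟨y, hy, t, ht, rfl⟩
      rw [ih] at hy
      rw [mem_nextLetters] at ht
      rw [isAscentSeq_concat, avoids0021_concat]
      exact ⟨by simp [hy.1], ⟨hy.2.1, ht.1⟩, hy.2.2, ht.2⟩
    · rintro ⟨hlen, hasc, hav⟩
      induction x using List.reverseRecOn with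
      | nil => simp at hlen
      | append_singleton y t _ =>
        rw [isAscentSeq_concat] at hasc
        rw [avoids0021_concat] at hav
        exact ⟨y, ih.2 ⟨by simpa using hlen, hasc.1, hav.1⟩, t,
          mem_nextLetters.2 ⟨hasc.2, hav.2⟩, rfl⟩

theorem concat_mem_avoiders {n : ℕ} {x : List ℕ} {t : ℕ} :
    x ++ [t] ∈ avoiders (n + 1) ↔ x ∈ avoiders n ∧ t ∈ nextLetters x := by
  rw [mem_avoiders, mem_avoiders, isAscentSeq_concat, avoids0021_concat, mem_nextLetters]
  simp
  tauto

theorem avoiders_one : avoiders 1 = {[0]} := by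
  simp [avoiders, nextLetters_nil]

theorem ne_nil_of_mem_avoiders {n : ℕ} {x : List ℕ} (hx : x ∈ avoiders (n + 1)) : x ≠ [] := by
  rintro rfl
  simpa using (mem_avoiders.1 hx).1

theorem zero_mem_of_mem_avoiders {n : ℕ} {x : List ℕ} (hx : x ∈ avoiders (n + 1)) : 0 ∈ x := by
  obtain ⟨hl, ha, -⟩ := mem_avoiders.1 hx
  have h0 : 0 < x.length := by omega
  rw [← ha.1 h0]
  exact List.getElem_mem h0

/-- The appended zero takes part in no new `a a c` with `a < c`, as it would have to be the
letter `c`. -/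
theorem nextLetters_concat_zero {x : List ℕ} (hx : x ≠ []) :
    nextLetters (x ++ [0]) = nextLetters x := by
  ext t
  rw [mem_nextLetters_of_ne_nil (by simp), mem_nextLetters_of_ne_nil hx, asc_concat x hx]
  simp only [Nat.not_lt_zero, if_false, add_zero, three_sublist_concat_iff]
  refine and_congr_right fun _ => ?_
  constructor
  · intro h a c hat htc hs
    exact h a c hat htc (Or.inl hs)
  · rintro h a c hat htc (hs | ⟨rfl, -⟩)
    · exact h a c hat htc hs
    · omega

theorem three_sublist_zero_cons_map_succ (u : List ℕ) (a c : ℕ) (hc : 0 < c) :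
    [a, a, c].Sublist (0 :: u.map Nat.succ) ↔
      ∃ a' c', a = a' + 1 ∧ c = c' + 1 ∧ [a', a', c'].Sublist u := by
  constructor
  · intro h
    have hsub : [a, c].Sublist (u.map Nat.succ) := by
      cases h with
      | cons _ h => exact (List.sublist_cons_self _ _).trans h
      | cons_cons _ h => exact h
    have ha : a ≠ 0 := by
      rintro rfl
      have := hsub.subset (List.mem_cons_self)
      simp at this
    cases h with
    | cons_cons _ h => exact absurd rfl ha
    | cons _ h =>
      obtain ⟨v, hv, he⟩ := List.sublist_map_iff.1 h
      match v, he with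
      | [p, q, r], he =>
        simp only [List.map_cons, List.map_nil, List.cons.injEq, and_true] at he
        obtain ⟨h1, h2, h3⟩ := he
        have : p = q := by omega
        subst this
        exact ⟨p, r, h1, h3, hv⟩
  · rintro ⟨a', c', rfl, rfl, h⟩
    exact (h.map Nat.succ).trans (List.sublist_cons_self _ _)

theorem succ_mem_nextLetters_zero_cons_map_succ {u : List ℕ} {t : ℕ} :
    t + 1 ∈ nextLetters (0 :: u.map Nat.succ) ↔ t ∈ nextLetters u := by
  rw [mem_nextLetters_of_ne_nil (by simp), mem_nextLetters]
  refine and_congr ?_ ?_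
  · rcases eq_or_ne u [] with rfl | hu
    · simp [asc]
    · rw [asc_zero_cons_map_succ u hu, if_neg hu]
      omega
  · constructor
    · intro h a c hat htc hs
      exact h (a + 1) (c + 1) (by omega) (by omega)
        ((three_sublist_zero_cons_map_succ u _ _ (by omega)).2 ⟨a, c, rfl, rfl, hs⟩)
    · intro h a c hat htc hs
      obtain ⟨a', c', rfl, rfl, hs'⟩ :=
        (three_sublist_zero_cons_map_succ u _ _ (by omega)).1 hs
      exact h a' c' (by omega) (by omega) hs'

theorem nextLetters_zero_cons_map_succ (u : List ℕ) :
    nextLetters (0 :: u.map Nat.succ) = insert 0 ((nextLetters u).image Nat.succ) := by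
  ext t
  cases t with
  | zero => simp [zero_mem_nextLetters]
  | succ t => simp [succ_mem_nextLetters_zero_cons_map_succ]

theorem zero_cons_map_succ_mem_avoiders {n : ℕ} {u : List ℕ} :
    0 :: u.map Nat.succ ∈ avoiders (n + 1) ↔ u ∈ avoiders n := by
  induction n generalizing u with
  | zero => simp [avoiders_one, show avoiders 0 = {[]} from rfl]
  | succ n ih =>
    induction u using List.reverseRecOn with
    | nil =>
      constructor
      · intro h
        simpa using (mem_avoiders.1 h).1
      · intro h
        simpa using (mem_avoiders.1 h).1
    | append_singleton v t _ =>
      have : 0 :: (v ++ [t]).map Nat.succ = (0 :: v.map Nat.succ) ++ [t + 1] := by simp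
      rw [this, concat_mem_avoiders, concat_mem_avoiders, ih,
        succ_mem_nextLetters_zero_cons_map_succ]

/-- Appending a positive letter to an avoider with two zeros: the remaining positive letters must
not descend, and an ascent makes one new letter available. -/
theorem mem_nextLetters_concat {x : List ℕ} {t s : ℕ} (hx : IsAscentSeq x)
    (h00 : 2 ≤ x.count 0) (ht : t ∈ nextLetters x) (ht0 : 0 < t) (hs0 : 0 < s) :
    s ∈ nextLetters (x ++ [t]) ↔
      (s ∈ nextLetters x ∧ t ≤ s) ∨ (x.getLastD 0 < t ∧ s = asc x + 2) := by
  have hne : x ≠ [] := by rintro rfl; simp at h00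
  have h00' : [0, 0].Sublist x := by
    simpa [List.replicate] using List.replicate_sublist_iff.2 h00
  have hbig : ∀ {a b c : ℕ}, [a, b, c].Sublist x → c ≤ asc x :=
    fun h => hx.le_asc _ (h.subset (by simp))
  rw [mem_nextLetters_of_ne_nil hne] at ht
  rw [mem_nextLetters_of_ne_nil (by simp), mem_nextLetters_of_ne_nil hne, asc_concat x hne]
  simp only [three_sublist_concat_iff]
  constructor
  · rintro ⟨h1, h2⟩
    have hts : t ≤ s := by
      by_contra hlt
      exact h2 0 t hs0 (by omega) (Or.inr ⟨rfl, h00'⟩)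
    rcases Nat.lt_or_ge (asc x + 1) s with hlt | hge
    · right
      split_ifs at h1 with hl
      · exact ⟨hl, by omega⟩
      · omega
    · exact Or.inl ⟨⟨hge, fun a c has hsc hsub => h2 a c has hsc (Or.inl hsub)⟩, hts⟩
  · rintro (⟨⟨h1, h2⟩, hts⟩ | ⟨hl, rfl⟩)
    · refine ⟨by omega, ?_⟩
      rintro a c has hsc (hsub | ⟨rfl, -⟩)
      · exact h2 a c has hsc hsub
      · omega
    · refine ⟨by rw [if_pos hl], ?_⟩
      rintro a c has hsc (hsub | ⟨rfl, -⟩)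
      · have := hbig hsub
        omega
      · omega

/-- The positive letters that may follow `x`. -/
noncomputable def posNextLetters (x : List ℕ) : Finset ℕ := (nextLetters x).erase 0

theorem card_nextLetters (x : List ℕ) : (nextLetters x).card = (posNextLetters x).card + 1 :=
  (Finset.card_erase_add_one (zero_mem_nextLetters x)).symm

theorem mem_posNextLetters {x : List ℕ} {t : ℕ} :
    t ∈ posNextLetters x ↔ t ≠ 0 ∧ t ∈ nextLetters x := Finset.mem_erase

theorem card_nextLetters_concat {x : List ℕ} {t : ℕ} (hx : IsAscentSeq x)
    (h00 : 2 ≤ x.count 0) (ht : t ∈ posNextLetters x) :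
    (nextLetters (x ++ [t])).card =
      ((posNextLetters x).filter (t ≤ ·)).card + (if x.getLastD 0 < t then 2 else 1) := by
  have hne : x ≠ [] := by rintro rfl; simp at h00
  rw [mem_posNextLetters] at ht
  have key : posNextLetters (x ++ [t]) = (posNextLetters x).filter (t ≤ ·) ∪
      (if x.getLastD 0 < t then {asc x + 2} else ∅) := by
    ext s
    rw [mem_posNextLetters, Finset.mem_union, Finset.mem_filter, mem_posNextLetters]
    rcases Nat.eq_zero_or_pos s with rfl | hs
    · split_ifs <;> simp
    · rw [mem_nextLetters_concat hx h00 ht.2 (Nat.pos_of_ne_zero ht.1) hs]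
      split_ifs with h
      · simp only [h, true_and, hs.ne', ne_eq, not_false_eq_true, Finset.mem_singleton]
      · simp only [h, false_and, hs.ne', ne_eq, not_false_eq_true, true_and,
          Finset.notMem_empty]
  rw [card_nextLetters, key, Finset.card_union_of_disjoint]
  · split_ifs <;> simp
  · split_ifs
    · rw [Finset.disjoint_singleton_right, Finset.mem_filter, mem_posNextLetters,
        mem_nextLetters_of_ne_nil hne]
      omega
    · simp

/-- In an avoider with two zeros and a positive last letter, this letter is the least positive
letter that may follow. -/
theorem isLeast_getLastD {n : ℕ} {x : List ℕ} (hx : x ∈ avoiders n) (h00 : 2 ≤ x.count 0)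
    (hl : x.getLastD 0 ≠ 0) : IsLeast (posNextLetters x : Set ℕ) (x.getLastD 0) := by
  obtain ⟨-, hasc, hav⟩ := mem_avoiders.1 hx
  induction x using List.reverseRecOn with
  | nil => simp at h00
  | append_singleton y t _ =>
    rw [List.getLastD_concat] at hl ⊢
    have hy00 : 2 ≤ y.count 0 := by simpa [List.count_append, hl] using h00
    rw [isAscentSeq_concat] at hasc
    rw [avoids0021_concat] at hav
    have ht : t ∈ nextLetters y := mem_nextLetters.2 ⟨hasc.2, hav.2⟩
    have htpos := Nat.pos_of_ne_zero hl
    constructor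
    · rw [Finset.mem_coe, mem_posNextLetters, mem_nextLetters_concat hasc.1 hy00 ht htpos htpos]
      exact ⟨hl, Or.inl ⟨ht, le_rfl⟩⟩
    · intro s hs
      rw [Finset.mem_coe, mem_posNextLetters] at hs
      have hne : y ≠ [] := by rintro rfl; simp at hy00
      have := hs.2
      rw [mem_nextLetters_concat hasc.1 hy00 ht htpos (Nat.pos_of_ne_zero hs.1)] at this
      rw [mem_nextLetters_of_ne_nil hne] at ht
      omega

/-! ### The succession rule and the ballot numbers -/

/-- The dual of the succession rule `r ↦ 3, 4, …, r + 1`: it sends `f` to the function whose value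
at `r` is the sum of `f` over the labels that `r` produces. -/
def succSum : Module.End ℤ (ℕ → ℤ) where
  toFun f r := ∑ i ∈ Finset.Ico 3 (r + 2), f i
  map_add' f g := by ext r; simp [Finset.sum_add_distrib]
  map_smul' c f := by ext r; simp [Finset.mul_sum]

theorem succSum_apply (f : ℕ → ℤ) (r : ℕ) :
    succSum f r = ∑ i ∈ Finset.Ico 3 (r + 2), f i := rfl

theorem succSum_succ (f : ℕ → ℤ) {r : ℕ} (hr : 1 ≤ r) :
    succSum f (r + 1) = succSum f r + f (r + 2) := by
  rw [succSum_apply, succSum_apply, Finset.sum_Ico_succ_top (by omega)]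

/-- Iterating the rule `r ↦ 3, …, r + 1` gives ballot numbers. The subtracted binomial coefficient
is written with lower index `k + i + 1` instead of the symmetric `k - 1`, so that `k = 0` is not
special. -/
theorem succSum_pow_one (k i : ℕ) :
    (succSum ^ k) 1 (i + 2) = ((2 * k + i).choose k : ℤ) - (2 * k + i).choose (k + i + 1) := by
  induction k generalizing i with
  | zero => simp
  | succ k ih =>
    rw [pow_succ', Module.End.mul_apply]
    induction i with
    | zero =>
      have h := ih 1
      rw [succSum_apply]
      simp only [zero_add, Nat.reduceAdd, Nat.Ico_succ_singleton,
        Finset.sum_singleton] at h ⊢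
      rw [h, show 2 * (k + 1) + 0 = 2 * k + 1 + 1 by ring,
        show k + 1 + 0 + 1 = k + 1 + 1 by ring, Nat.choose_succ_succ (2 * k + 1) k,
        Nat.choose_succ_succ (2 * k + 1) (k + 1)]
      push_cast
      ring
    | succ i ihi =>
      rw [show i + 1 + 2 = (i + 2) + 1 by ring, succSum_succ _ (by omega), ihi,
        show i + 2 + 2 = (i + 2) + 2 by ring, ih (i + 2),
        show 2 * (k + 1) + (i + 1) = 2 * k + (i + 2) + 1 by ring,
        show 2 * (k + 1) + i = 2 * k + (i + 2) by ring,
        show k + 1 + (i + 1) + 1 = k + i + 2 + 1 by ring, Nat.choose_succ_succ,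
        Nat.choose_succ_succ _ (k + i + 2), show k + 1 + i + 1 = k + i + 2 by ring,
        show k + (i + 2) + 1 = k + i + 3 by ring]
      push_cast
      ring

theorem succSum_pow_one_two (k : ℕ) : (succSum ^ k) 1 2 = catalan k := by
  have h := succSum_pow_one k 0
  simp only [zero_add, add_zero] at h
  rw [h]
  have h1 := succ_mul_catalan_eq_centralBinom k
  rw [Nat.centralBinom] at h1
  have h2 := Nat.choose_succ_right_eq (2 * k) k
  rw [show 2 * k - k = k by omega] at h2
  have h3 : ((k : ℤ) + 1) * catalan k = (2 * k).choose k := by exact_mod_cast h1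
  have h4 : ((2 * k).choose (k + 1) : ℤ) * (k + 1) = (2 * k).choose k * k := by exact_mod_cast h2
  have hk : (k : ℤ) + 1 ≠ 0 := by positivity
  apply mul_left_cancel₀ hk
  linear_combination -h3 - h4

theorem one_add_succSum_pow_one_two (n : ℕ) :
    ((1 + succSum) ^ n) 1 2 = ∑ k ∈ Finset.range (n + 1), (n.choose k : ℤ) * catalan k := by
  rw [add_comm, (Commute.one_right succSum).add_pow, LinearMap.sum_apply, Finset.sum_apply]
  refine Finset.sum_congr rfl fun k _ => ?_
  rw [one_pow, mul_one, ← nsmul_eq_mul', LinearMap.smul_apply, Pi.smul_apply,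
    succSum_pow_one_two, nsmul_eq_mul]

/-- Summing `g` over the ranks, counted from the top, of the elements of a finite set. -/
theorem sum_card_filter_le (P : Finset ℕ) (g : ℕ → ℤ) :
    ∑ t ∈ P, g (P.filter (t ≤ ·)).card = ∑ i ∈ Finset.range P.card, g (i + 1) := by
  induction P using Finset.induction_on_min with
  | empty => simp
  | insert a s ha ih =>
    have hnot : a ∉ s := fun h => (ha a h).false
    rw [Finset.sum_insert hnot, Finset.card_insert_of_notMem hnot, Finset.sum_range_succ, ← ih,
      add_comm]
    congr 1
    · refine Finset.sum_congr rfl fun t ht => ?_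
      rw [Finset.filter_insert, if_neg (by have := ha t ht; omega)]
    · rw [Finset.filter_true_of_mem, Finset.card_insert_of_notMem hnot]
      intro x hx
      rcases Finset.mem_insert.1 hx with rfl | hx
      · exact le_rfl
      · exact (ha x hx).le

/-- The labels of the children obtained by appending a positive letter to a word `x` with two
zeros: `3, …, r + 1`, except that the last of them drops to `r` if `x` ends in a positive letter,
because repeating that letter is not an ascent. -/
theorem sum_posNextLetters {n : ℕ} {x : List ℕ} (hx : x ∈ avoiders n) (h00 : 2 ≤ x.count 0)
    (f : ℕ → ℤ) :
    ∑ t ∈ posNextLetters x, f (nextLetters (x ++ [t])).card =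
      succSum f (nextLetters x).card +
        if x.getLastD 0 = 0 then 0
        else f (nextLetters x).card - f ((nextLetters x).card + 1) := by
  have hasc := (mem_avoiders.1 hx).2.1
  have hrank : ∑ t ∈ posNextLetters x, f (((posNextLetters x).filter (t ≤ ·)).card + 2) =
      succSum f (nextLetters x).card := by
    rw [sum_card_filter_le _ fun i => f (i + 2), succSum_apply, card_nextLetters,
      Finset.sum_Ico_eq_sum_range]
    refine Finset.sum_congr (by congr 1) fun i _ => ?_
    congr 1
    ring
  rw [← hrank]
  split_ifs with hl
  · rw [add_zero]
    refine Finset.sum_congr rfl fun t ht => ?_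
    rw [card_nextLetters_concat hasc h00 ht, hl,
      if_pos (Nat.pos_of_ne_zero (mem_posNextLetters.1 ht).1)]
  -- The last letter of `x` is the least admissible one, so it has the top rank, and it is the only
  -- one whose addition creates no new letter.
  · obtain ⟨hmem, hmin⟩ := isLeast_getLastD hx h00 hl
    have hcard : ((posNextLetters x).filter (x.getLastD 0 ≤ ·)).card =
        (posNextLetters x).card := by
      rw [Finset.filter_true_of_mem fun s hs => hmin hs]
    rw [← Finset.add_sum_erase _ _ hmem, ← Finset.add_sum_erase (posNextLetters x)
      (fun t => f (((posNextLetters x).filter (t ≤ ·)).card + 2)) hmem,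
      card_nextLetters_concat hasc h00 hmem, if_neg (lt_irrefl _), hcard, card_nextLetters x]
    have : ∀ t ∈ (posNextLetters x).erase (x.getLastD 0),
        f (nextLetters (x ++ [t])).card =
          f (((posNextLetters x).filter (t ≤ ·)).card + 2) := by
      intro t ht
      obtain ⟨hne, ht⟩ := Finset.mem_erase.1 ht
      rw [card_nextLetters_concat hasc h00 ht, if_pos (lt_of_le_of_ne (hmin ht) hne.symm)]
    rw [Finset.sum_congr rfl this]
    ring_nf

/-! ### Sums of a function of the label over the avoiders -/

/-- The sum of `f r` over the avoiders of length `n`, where `r` is the number of children of the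
avoider in the generating tree. -/
noncomputable def labelSum (n : ℕ) (f : ℕ → ℤ) : ℤ :=
  ∑ x ∈ avoiders n, f (nextLetters x).card

/-- The avoiders of length `n` with at least two zeros. -/
noncomputable def twoZeroAvoiders (n : ℕ) : Finset (List ℕ) :=
  (avoiders n).filter fun x => 2 ≤ x.count 0

/-- The sum of `f r` over the avoiders of length `n` with at least two zeros and a positive last
letter, where `r` is the number of children. -/
noncomputable def posLabelSum (n : ℕ) (f : ℕ → ℤ) : ℤ :=
  ∑ x ∈ (twoZeroAvoiders n).filter (fun x => x.getLastD 0 ≠ 0), f (nextLetters x).card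

/-- The avoiders with a single zero are the words `0 (u + 1)` with `u` an avoider. -/
theorem sum_avoiders_single_zero (n : ℕ) (F : List ℕ → ℤ) :
    ∑ x ∈ (avoiders (n + 1)).filter (fun x => ¬ 2 ≤ x.count 0), F x =
      ∑ u ∈ avoiders n, F (0 :: u.map Nat.succ) := by
  symm
  refine Finset.sum_bij (fun u _ => 0 :: u.map Nat.succ) ?_ ?_ ?_ (fun _ _ => rfl)
  · intro u hu
    have : (u.map Nat.succ).count 0 = 0 := List.count_eq_zero.2 (by simp)
    simp only [Finset.mem_filter, zero_cons_map_succ_mem_avoiders]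
    refine ⟨hu, ?_⟩
    rw [List.count_cons_self, this]
    omega
  · intro u _ v _ h
    exact List.map_injective_iff.2 Nat.succ_injective (List.cons.inj h).2
  · intro x hx
    obtain ⟨hx, hc⟩ := Finset.mem_filter.1 hx
    obtain ⟨hlen, hasc, -⟩ := mem_avoiders.1 hx
    cases x with
    | nil => simp at hlen
    | cons a y =>
      have ha : a = 0 := hasc.1 (by simp)
      subst ha
      rw [List.count_cons_self] at hc
      have hy : 0 ∉ y := List.count_eq_zero.1 (by omega)
      have hmap : (y.map Nat.pred).map Nat.succ = y := by
        rw [List.map_map]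
        refine (List.map_congr_left fun b hb => ?_).trans (List.map_id y)
        have : b ≠ 0 := fun h => hy (h ▸ hb)
        simp only [Function.comp_apply, id]
        exact Nat.succ_pred this
      refine ⟨y.map Nat.pred, ?_, ?_⟩
      · rw [← zero_cons_map_succ_mem_avoiders, hmap]
        exact hx
      · rw [hmap]

theorem sum_twoZeroAvoiders_last_zero (n : ℕ) (F : List ℕ → ℤ) :
    ∑ x ∈ (twoZeroAvoiders (n + 2)).filter (fun x => ¬ x.getLastD 0 ≠ 0), F x =
      ∑ y ∈ avoiders (n + 1), F (y ++ [0]) := by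
  symm
  refine Finset.sum_bij (fun y _ => y ++ [0]) ?_ ?_ ?_ (fun _ _ => rfl)
  · intro y hy
    have h0 : 0 < y.count 0 := List.count_pos_iff.2 (zero_mem_of_mem_avoiders hy)
    simp only [twoZeroAvoiders, Finset.mem_filter, List.getLastD_concat, concat_mem_avoiders,
      List.count_append, List.count_singleton_self]
    exact ⟨⟨⟨hy, zero_mem_nextLetters y⟩, by omega⟩, by simp⟩
  · intro u _ v _ h
    exact List.append_cancel_right h
  · intro x hx
    simp only [twoZeroAvoiders, Finset.mem_filter, not_not] at hx
    obtain ⟨⟨hx, hc⟩, hl⟩ := hx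
    induction x using List.reverseRecOn with
    | nil => simp at hc
    | append_singleton y t _ =>
      rw [List.getLastD_concat] at hl
      subst hl
      exact ⟨y, (concat_mem_avoiders.1 hx).1, rfl⟩

theorem posLabelSum_succ_eq_sum (n : ℕ) (f : ℕ → ℤ) :
    posLabelSum (n + 1) f =
      ∑ y ∈ twoZeroAvoiders n, ∑ t ∈ posNextLetters y, f (nextLetters (y ++ [t])).card := by
  rw [Finset.sum_sigma', posLabelSum]
  symm
  refine Finset.sum_bij (fun p _ => p.1 ++ [p.2]) ?_ ?_ ?_ (fun _ _ => rfl)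
  · rintro ⟨y, t⟩ h
    simp only [Finset.mem_sigma, twoZeroAvoiders, Finset.mem_filter, mem_posNextLetters] at h
    simp only [twoZeroAvoiders, Finset.mem_filter, List.getLastD_concat, concat_mem_avoiders,
      List.count_append]
    exact ⟨⟨⟨h.1.1, h.2.2⟩, h.1.2.trans (Nat.le_add_right _ _)⟩, h.2.1⟩
  · rintro ⟨y, t⟩ _ ⟨z, s⟩ _ h
    obtain ⟨rfl, h⟩ := List.append_inj' h rfl
    obtain rfl : t = s := by simpa using h
    rfl
  · intro x hx
    simp only [twoZeroAvoiders, Finset.mem_filter] at hx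
    obtain ⟨⟨hx, hc⟩, hl⟩ := hx
    induction x using List.reverseRecOn with
    | nil => simp at hc
    | append_singleton y t _ =>
      rw [List.getLastD_concat] at hl
      obtain ⟨hy, ht⟩ := concat_mem_avoiders.1 hx
      refine ⟨⟨y, t⟩, ?_, rfl⟩
      simp only [Finset.mem_sigma, twoZeroAvoiders, Finset.mem_filter, mem_posNextLetters]
      exact ⟨⟨hy, by simpa [List.count_append, hl] using hc⟩, hl, ht⟩

theorem sum_single_zero_label (n : ℕ) (f : ℕ → ℤ) :
    ∑ x ∈ (avoiders (n + 1)).filter (fun x => ¬ 2 ≤ x.count 0), f (nextLetters x).card =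
      labelSum n fun r => f (r + 1) := by
  rw [sum_avoiders_single_zero n fun x => f (nextLetters x).card, labelSum]
  refine Finset.sum_congr rfl fun u _ => ?_
  rw [nextLetters_zero_cons_map_succ, Finset.card_insert_of_notMem (by simp),
    Finset.card_image_of_injective _ Nat.succ_injective]

/-- The contributions of the words ending in a second or later zero, of those with a single zero,
and of the remaining ones. -/
theorem labelSum_add_two (n : ℕ) (f : ℕ → ℤ) :
    labelSum (n + 2) f = labelSum (n + 1) f + labelSum (n + 1) (fun r => f (r + 1)) +
      posLabelSum (n + 2) f := by
  rw [labelSum, ← Finset.sum_filter_add_sum_filter_not _ fun x => 2 ≤ x.count 0,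
    sum_single_zero_label, ← twoZeroAvoiders,
    ← Finset.sum_filter_add_sum_filter_not _ fun x => x.getLastD 0 ≠ 0, ← posLabelSum,
    sum_twoZeroAvoiders_last_zero n fun x => f (nextLetters x).card]
  have : ∑ y ∈ avoiders (n + 1), f (nextLetters (y ++ [0])).card = labelSum (n + 1) f :=
    Finset.sum_congr rfl fun y hy => by
      rw [nextLetters_concat_zero (ne_nil_of_mem_avoiders hy)]
  rw [this]
  ring

/-- The parents of the words counted by `posLabelSum` are all words with two zeros, that is, all
avoiders but those with a single zero; parents ending in a positive letter need a correction. -/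
theorem posLabelSum_add_two (n : ℕ) (f : ℕ → ℤ) :
    posLabelSum (n + 2) f =
      labelSum (n + 1) (succSum f) - labelSum n (fun r => succSum f (r + 1)) +
        posLabelSum (n + 1) (fun r => f r - f (r + 1)) := by
  have hsplit : labelSum (n + 1) (succSum f) =
      ∑ x ∈ twoZeroAvoiders (n + 1), succSum f (nextLetters x).card +
        labelSum n (fun r => succSum f (r + 1)) := by
    rw [← sum_single_zero_label, twoZeroAvoiders, labelSum, Finset.sum_filter_add_sum_filter_not]
  rw [hsplit, add_sub_cancel_right, posLabelSum_succ_eq_sum, posLabelSum, Finset.sum_filter,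
    ← Finset.sum_add_distrib]
  refine Finset.sum_congr rfl fun x hx => ?_
  obtain ⟨hx, h00⟩ := Finset.mem_filter.1 hx
  rw [sum_posNextLetters hx h00, ite_not]

theorem labelSum_add (n : ℕ) (f g : ℕ → ℤ) :
    labelSum n (f + g) = labelSum n f + labelSum n g := Finset.sum_add_distrib

theorem labelSum_sub (n : ℕ) (f g : ℕ → ℤ) :
    labelSum n (f - g) = labelSum n f - labelSum n g := Finset.sum_sub_distrib _ _

theorem labelSum_congr (n : ℕ) {f g : ℕ → ℤ} (h : ∀ r, 1 ≤ r → f r = g r) :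
    labelSum n f = labelSum n g :=
  Finset.sum_congr rfl fun x _ => h _ (Finset.card_pos.2 ⟨0, zero_mem_nextLetters x⟩)

theorem labelSum_one (f : ℕ → ℤ) : labelSum 1 f = f 2 := by
  have : nextLetters [0] = insert 0 ((nextLetters []).image Nat.succ) :=
    nextLetters_zero_cons_map_succ []
  rw [labelSum, avoiders_one, Finset.sum_singleton, this, nextLetters_nil]
  rfl

/-- The words with two zeros and a positive last letter make up exactly the difference between the
succession rule `r ↦ 3, …, r + 1` and the shift `r ↦ r + 1`. -/
theorem posLabelSum_eq (n : ℕ) (f : ℕ → ℤ) :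
    posLabelSum (n + 2) f =
      labelSum (n + 1) (succSum f) - labelSum (n + 1) (fun r => f (r + 1)) := by
  induction n generalizing f with
  | zero =>
    rw [posLabelSum_succ_eq_sum, labelSum_one, labelSum_one, twoZeroAvoiders, avoiders_one,
      succSum_apply]
    simp [Finset.filter_singleton]
  | succ n ih =>
    rw [posLabelSum_add_two, ih, labelSum_add_two n fun r => f (r + 1), ih]
    -- The remaining identity is `succSum f r + f (r + 2) = succSum f (r + 1)`, summed over labels.
    have e : labelSum (n + 1) (fun r => succSum f (r + 1)) =
        labelSum (n + 1) (succSum f) + labelSum (n + 1) (fun r => f (r + 2)) := by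
      rw [← labelSum_add]
      exact labelSum_congr _ fun r hr => succSum_succ f hr
    have e1 : labelSum (n + 1) (succSum fun r => f r - f (r + 1)) =
        labelSum (n + 1) (succSum f) - labelSum (n + 1) (succSum fun r => f (r + 1)) := by
      rw [← labelSum_sub, ← map_sub]
      rfl
    have e2 : labelSum (n + 1) (fun r => f (r + 1) - f (r + 1 + 1)) =
        labelSum (n + 1) (fun r => f (r + 1)) - labelSum (n + 1) (fun r => f (r + 2)) := by
      rw [← labelSum_sub]
      rfl
    rw [e, e1, e2]
    ring

/-- The labels follow the rule `r ↦ r, 3, 4, …, r + 1`. -/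
theorem labelSum_succ (n : ℕ) (f : ℕ → ℤ) :
    labelSum (n + 2) f = labelSum (n + 1) ((1 + succSum) f) := by
  rw [labelSum_add_two, posLabelSum_eq, LinearMap.add_apply, labelSum_add, Module.End.one_apply]
  ring

theorem labelSum_eq_pow (n : ℕ) (f : ℕ → ℤ) :
    labelSum (n + 1) f = ((1 + succSum) ^ n) f 2 := by
  induction n generalizing f with
  | zero => simp [labelSum_one]
  | succ n ih => rw [labelSum_succ, ih, pow_succ, Module.End.mul_apply]

theorem theorem4 (n : ℕ) (hn : 1 ≤ n) :
    (avoidingAscentSeqs [[0, 0, 2, 1]] n).ncard =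
      ∑ k ∈ Finset.range n, (n - 1).choose k * catalan k := by
  have hset : avoidingAscentSeqs [[0, 0, 2, 1]] n = (avoiders n : Set (List ℕ)) := by
    ext x
    simp [avoidingAscentSeqs, mem_avoiders, not_containsPattern_iff]
  obtain ⟨m, rfl⟩ := Nat.exists_eq_add_of_le' hn
  rw [hset, Set.ncard_coe_finset, Nat.add_sub_cancel]
  have h : ((avoiders (m + 1)).card : ℤ) = labelSum (m + 1) 1 := by simp [labelSum]
  rw [labelSum_eq_pow, one_add_succSum_pow_one_two] at h
  exact_mod_cast h
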